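/- Let $K$ be a number field and $G$ a finite group. A $G$-extension is a Galois extension of fields with Galois group isomorphic to $G$; "unramified" and "tame" (that is, at most tamely ramified) refer to all finite (nonzero) primes. Let $e(K,G)\in\{1,2,\dots\}\cup\{\infty\}$ be the smallest degree $[M:K]$ of a number field $M\supseteq K$ which admits an unramified $G$-extension $L/M$ that is defined over $K$ by a tame $G$-extension, i.e. for which there is a tame $G$-extension $L_0/K$ with $L_0\otimes_K M\cong L$ over $M$. Let $e'(K,G)\in\{1,2,\dots\}\cup\{\infty\}$ be the smallest positive integer $e'$ such that $K$ admits a tame $G$-extension all of whose inertia groups (at finite primes) have order dividing $e'$. (The minimum of the empty set is $\infty$.) Then $$e(K,G)=e'(K,G).$$ In particular, $$e(\mathbb{Q},G)\ge \operatorname{ge}(G):=\min_S \operatorname{lcm}\{\operatorname{ord}(x): x\in S\},$$ where $S$ runs over all generating subsets of $G$. -/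

import Mathlib

open NumberField
open scoped TensorProduct

universe u v

/-- `L/K` is a `G`-extension: a Galois extension of fields with Galois group isomorphic to `G`. -/
def IsGExtension (K : Type*) (L : Type*) (G : Type*) [Field K] [Field L] [Algebra K L]
    [Group G] : Prop :=
  IsGalois K L ∧ Nonempty (Gal(L/K) ≃* G)

/-- The extension of number fields `L/K` is unramified at all (finite) primes: every nonzero prime
of `L` has ramification index one over `K`. (Residue fields are finite, so the residue
extensions are automatically separable.) -/
def IsUnramifiedExtension (K : Type*) (L : Type*) [Field K] [Field L] [Algebra K L] : Prop :=
  ∀ P : Ideal (𝓞 L), P.IsPrime → P ≠ ⊥ → P.ramificationIdx (𝓞 K) = 1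

/-- The extension of number fields `L/K` is (at most) tamely ramified: the ramification index
over `K` of every nonzero prime of `L` is not divisible by the residue characteristic. -/
def IsTameExtension (K : Type*) (L : Type*) [Field K] [Field L] [Algebra K L] : Prop :=
  ∀ P : Ideal (𝓞 L), P.IsPrime → P ≠ ⊥ →
    ¬ ringChar (𝓞 L ⧸ P) ∣ P.ramificationIdx (𝓞 K)

/-- The number field `M ⊇ K` admits an unramified `G`-extension `L/M` which is defined over `K` by
a tame `G`-extension `L₀/K`, i.e. `L₀ ⊗_K M` and `L` are isomorphic over `M`. -/
def AdmitsUnramifiedTamelyDefined (K : Type u) (M : Type u) (G : Type v) [Field K] [Field M]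
    [Algebra K M] [Group G] : Prop :=
  ∃ (L : Type u) (_ : Field L) (_ : NumberField L) (_ : Algebra M L)
    (L₀ : Type u) (_ : Field L₀) (_ : NumberField L₀) (_ : Algebra K L₀),
    IsGExtension M L G ∧ IsUnramifiedExtension M L ∧
    IsGExtension K L₀ G ∧ IsTameExtension K L₀ ∧
    Nonempty ((M ⊗[K] L₀) ≃ₐ[M] L)

/-- The degrees `[M : K]` of the overfields `M` of `K` that admit an unramified `G`-extension
defined over `K` by a tame `G`-extension. -/
def unramifiedOverfieldDegrees (K : Type u) (G : Type v) [Field K] [Group G] : Set ℕ :=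
  {n | ∃ (M : Type u) (_ : Field M) (_ : NumberField M) (_ : Algebra K M),
    AdmitsUnramifiedTamelyDefined K M G ∧ Module.finrank K M = n}

/-- The positive integers `n` such that `K` admits a tame `G`-extension `L` all of whose inertia
groups (at the nonzero primes of `L`) have order dividing `n`. -/
def tameInertiaBounds (K : Type u) (G : Type v) [Field K] [Group G] : Set ℕ :=
  {n | 0 < n ∧ ∃ (L : Type u) (_ : Field L) (_ : NumberField L) (_ : Algebra K L),
    IsGExtension K L G ∧ IsTameExtension K L ∧
    ∀ P : Ideal (𝓞 L), P.IsPrime → P ≠ ⊥ → Nat.card (P.inertia Gal(L/K)) ∣ n}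

/-- `e(K,G)`: the least degree of an overfield of `K` that admits an unramified `G`-extension
defined over `K` by a tame `G`-extension (`⊤` if there is none). -/
noncomputable def minUnramifiedDegree (K : Type u) (G : Type v) [Field K] [Group G] : ℕ∞ :=
  ⨅ n ∈ unramifiedOverfieldDegrees K G, (n : ℕ∞)

/-- `e'(K,G)`: the least positive integer `n` such that `K` has a tame `G`-extension with all
inertia groups of order dividing `n` (`⊤` if there is none). -/
noncomputable def minInertiaBound (K : Type u) (G : Type v) [Field K] [Group G] : ℕ∞ :=
  ⨅ n ∈ tameInertiaBounds K G, (n : ℕ∞)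

/-- The generator exponent `ge(G)` of a finite group: the least value of `lcm {ord x | x ∈ S}`
over all generating subsets `S` of `G`. (For finite `G` all subsets are finite, and `S = G` shows
that the minimum is over a nonempty set.) -/
noncomputable def generatorExponent (G : Type v) [Group G] : ℕ :=
  sInf {n | ∃ S : Finset G, Subgroup.closure (S : Set G) = ⊤ ∧ n = S.lcm orderOf}

/-!
The equality `e(K, G) = e'(K, G)` holds because the two sets of degrees coincide.

If `L/M` is unramified and `L = L₀M` with `L₀/K` Galois, then at every prime `Q` of `M` above a prime
`p` of `K` the ramification index of `p` in `L₀` divides `e(Q|p)`. By the formula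
`[M : K] = ∑ e(Q|p) f(Q|p)` it divides `[M : K]` (`ramificationIdx_dvd_finrank`), and it is
the order of the inertia groups above `p`.

Conversely, let `L₀/K` be a tame `G`-extension whose inertia groups have order dividing `n`. Choose
`a` in `K` of order one at all primes that ramify in `L₀` and at one further prime `q` that does not
(`exists_tame_radicand`), and set `M = K(a^(1/n))`. By Eisenstein's criterion at a prime above `q`,
`X ^ n - a` is irreducible over `L₀`, so `L = M ⊗ L₀` is a field, and it is a `G`-extension of `M`.
It is unramified by a direct argument in the style of Abhyankar's lemma
(`isUnramifiedExtension_of_pow_eq`): an element `σ` of an inertia group of `L/M` fixes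
`β = a^(1/e)`, where `e` divides `n` and is the ramification index of the prime `P` of `L₀` below;
comparison with `β` shows that the restriction of `σ` to `L₀`, an inertia element, acts trivially on
`P / P ^ 2` (`smul_sub_mem_sq_of_pow_eq`). By tameness its order is prime to the residue
characteristic, and such an element is trivial (`smul_eq_of_tame`).

For `K = ℚ`, the inertia groups of `L₀` generate the Galois group since `ℚ` has no unramified
extension (`iSup_inertia_eq_top`). Their union is thus a generating set, all of whose elements
have order dividing the common bound `n`, so `ge(G) ≤ e'(ℚ, G)`.
-/

/-! ### Ramification indices in a compositum -/

theorem card_inertia_eq_ramificationIdx {K L : Type*} [Field K] [NumberField K] [Field L]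
    [NumberField L] [Algebra K L] [IsGalois K L] (P : Ideal (𝓞 L)) [P.IsPrime] :
    Nat.card (P.inertia Gal(L/K)) = P.ramificationIdx (𝓞 K) := by
  rw [Ideal.card_inertia_eq_ramificationIdxIn (R := 𝓞 K) (G := Gal(L/K)) (P.under (𝓞 K)) P,
    Ideal.ramificationIdxIn_eq_ramificationIdx (P.under (𝓞 K)) P Gal(L/K)]

/-- Base change to `M` can only make `L₀/K` unramified if `M` absorbs its ramification: if a field
`L` containing `M` and `L₀` is unramified over `M`, then `e(Q|K) = e(R|K)` for primes `R` of `L`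
above `Q` of `M`, so `e(P|K)` divides `e(Q|K)` for all `Q` above `P ∩ K`, hence also
`[M : K] = ∑ e(Q|K) f(Q|K)`. -/
theorem ramificationIdx_dvd_finrank {K M L₀ L : Type*} [Field K] [NumberField K] [Field M]
    [NumberField M] [Field L₀] [NumberField L₀] [Field L] [NumberField L] [Algebra K M]
    [Algebra K L₀] [Algebra K L] [Algebra M L] [Algebra L₀ L] [IsScalarTower K M L]
    [IsScalarTower K L₀ L] [IsGalois K L₀] (hL : IsUnramifiedExtension M L)
    (P : Ideal (𝓞 L₀)) [P.IsPrime] (hP : P ≠ ⊥) :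
    P.ramificationIdx (𝓞 K) ∣ Module.finrank K M := by
  classical
  set p := P.under (𝓞 K) with hp
  have hp0 : p ≠ ⊥ := fun h ↦ hP (Ideal.eq_bot_of_comap_eq_bot h)
  have : p.IsMaximal := (inferInstance : p.IsPrime).isMaximal hp0
  have : Fintype (p.primesOver (𝓞 M)) := (IsDedekindDomain.primesOver_finite p (𝓞 M)).fintype
  rw [IsFractionRing.finrank_eq (𝓞 K) K (𝓞 M) M,
    ← Ideal.sum_ramification_inertia_eq_finrank p (𝓞 M)]
  refine Finset.dvd_sum fun ⟨Q, hQ, hQp⟩ _ ↦ Dvd.dvd.mul_right ?_ _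
  have hQ0 : Q ≠ ⊥ := Ideal.ne_bot_of_liesOver_of_ne_bot hp0 Q
  obtain ⟨R, hR, hRQ⟩ := (inferInstance : Nonempty (Q.primesOver (𝓞 L)))
  have hRp : R.LiesOver p := .trans R Q p
  have hP' : (R.under (𝓞 L₀)).LiesOver p := Ideal.LiesOver.tower_bot R _ p
  have hR0 : R ≠ ⊥ := Ideal.ne_bot_of_liesOver_of_ne_bot hQ0 R
  have h1 := Ideal.ramificationIdx_tower (R := 𝓞 K) Q R
  rw [hL R hR hR0, mul_one] at h1
  have : P.LiesOver p := ⟨hp⟩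
  rw [Ideal.ramificationIdx_eq_of_isGaloisGroup p P (R.under (𝓞 L₀)) Gal(L₀/K), ← h1]
  exact Ideal.ramificationIdx_below_dvd _ R

/-! ### Base change of Galois extensions -/

/-- The hypothesis on `M ⊗ L₀`, that it is a field, is expressed by the isomorphism with `L`. -/
theorem IsGExtension.of_tensorProduct_algEquiv {K M L₀ L G : Type*} [Field K] [Field M] [Field L₀]
    [Field L] [Group G] [Finite G] [Algebra K M] [Algebra K L₀] [Algebra M L]
    (Φ : M ⊗[K] L₀ ≃ₐ[M] L) (h : IsGExtension K L₀ G) : IsGExtension M L G := by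
  obtain ⟨hgal, ⟨φ⟩⟩ := h
  have : Finite Gal(L₀/K) := .of_equiv _ φ.symm.toEquiv
  have : FiniteDimensional K L₀ := IsGaloisGroup.finiteDimensional Gal(L₀/K) K L₀
  have : FiniteDimensional M L := Module.Finite.equiv Φ.toLinearEquiv
  -- every automorphism of `L₀` over `K` acts on the second factor of `M ⊗ L₀`
  let ψ : Gal(L₀/K) →* Gal(L/M) :=
    { toFun τ := (Φ.symm.trans (Algebra.TensorProduct.congr .refl τ)).trans Φ
      map_one' := by
        ext x
        have : (Algebra.TensorProduct.congr .refl 1 : M ⊗[K] L₀ ≃ₐ[M] M ⊗[K] L₀) = .refl :=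
          Algebra.TensorProduct.congr_refl
        simp [this]
      map_mul' σ τ := by
        ext x
        have : (Algebra.TensorProduct.congr .refl (σ * τ) : M ⊗[K] L₀ ≃ₐ[M] M ⊗[K] L₀) =
            (Algebra.TensorProduct.congr .refl τ).trans (Algebra.TensorProduct.congr .refl σ) := by
          rw [← Algebra.TensorProduct.congr_trans]; rfl
        simp [this] }
  have hψ : Function.Injective ψ := by
    refine fun σ τ h ↦ AlgEquiv.ext fun x ↦ ?_
    have h1 := congr($h (Φ (1 ⊗ₜ x)))
    have h2 : (1 : M) ⊗ₜ[K] σ x = 1 ⊗ₜ τ x := by simpa [ψ] using h1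
    exact Algebra.TensorProduct.includeRight_injective (A := M) (B := L₀)
      (algebraMap K M).injective h2
  have hrank : Module.finrank M L = Nat.card Gal(L₀/K) := by
    rw [← Φ.toLinearEquiv.finrank_eq, Module.finrank_baseChange, IsGalois.card_aut_eq_finrank]
  have hcard : Nat.card Gal(L/M) = Nat.card Gal(L₀/K) := by
    refine le_antisymm ?_ (Nat.card_le_card_of_injective ψ hψ)
    rw [← hrank, Nat.card_eq_fintype_card]
    exact AlgEquiv.card_le
  refine ⟨IsGalois.of_card_aut_eq_finrank M L (hcard.trans hrank.symm), ⟨?_⟩⟩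
  exact (MulEquiv.ofBijective ψ ((Nat.bijective_iff_injective_and_card ψ).2
    ⟨hψ, hcard.symm⟩)).symm.trans φ

theorem mem_tameInertiaBounds_of_mem_unramifiedOverfieldDegrees {K : Type*} [Field K]
    [NumberField K] {G : Type*} [Group G] {n : ℕ} (hn : n ∈ unramifiedOverfieldDegrees K G) :
    n ∈ tameInertiaBounds K G := by
  obtain ⟨M, _, _, _, ⟨L, _, _, _, L₀, _, _, _, -, hunr, hgal, htame, ⟨Φ⟩⟩, rfl⟩ := hn
  refine ⟨Module.finrank_pos, L₀, _, ‹_›, _, hgal, htame, fun P hP hP0 ↦ ?_⟩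
  have := hgal.1
  let : Algebra K L := ((algebraMap M L).comp (algebraMap K M)).toAlgebra
  have : IsScalarTower K M L := .of_algebraMap_eq' rfl
  let : Algebra L₀ L :=
    ((Φ : M ⊗[K] L₀ →+* L).comp Algebra.TensorProduct.includeRight.toRingHom).toAlgebra
  have : IsScalarTower K L₀ L := .of_algebraMap_eq fun x ↦ by
    change algebraMap M L (algebraMap K M x) = Φ (1 ⊗ₜ algebraMap K L₀ x)
    rw [← Φ.commutes, ← Algebra.TensorProduct.includeRight_apply (R := K) (A := M),
      AlgHom.commutes]
    rfl
  rw [card_inertia_eq_ramificationIdx]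
  exact ramificationIdx_dvd_finrank hunr P hP0

/-! ### Generation by inertia groups over the rationals -/

/-- The inertia groups generate the Galois group of `L/ℚ`: the subfield fixed by all of them is
unramified over `ℚ`, hence equal to `ℚ` by the Hermite–Minkowski theorem. -/
theorem iSup_inertia_eq_top {L : Type*} [Field L] [NumberField L] [IsGalois ℚ L] :
    ⨆ P : {P : Ideal (𝓞 L) // P.IsPrime ∧ P ≠ ⊥}, P.1.inertia Gal(L/ℚ) = ⊤ := by
  set H := ⨆ P : {P : Ideal (𝓞 L) // P.IsPrime ∧ P ≠ ⊥}, P.1.inertia Gal(L/ℚ) with hH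
  set F := IntermediateField.fixedField H
  have hF : IsGaloisGroup H F L := IsGaloisGroup.subgroup Gal(L/ℚ) ℚ L H
  have hFO : IsGaloisGroup H (𝓞 F) (𝓞 L) := IsGaloisGroup.of_isFractionRing H (𝓞 F) (𝓞 L) F L
  by_contra hne
  have hF1 : Module.finrank ℚ F ≠ 1 := by
    intro h
    rw [IntermediateField.finrank_eq_one_iff] at h
    apply hne
    rw [← IntermediateField.fixingSubgroup_fixedField H,
      show IntermediateField.fixedField H = ⊥ from h, IntermediateField.fixingSubgroup_bot]
  obtain ⟨p, hp, hram⟩ := NumberField.exists_not_isUnramifiedAt_int (𝒪 := 𝓞 F) hF1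
  apply hram
  obtain ⟨P, hP, hPp⟩ := (inferInstance : Nonempty (p.primesOver (𝓞 L)))
  have hp0 : p ≠ ⊥ := Ideal.IsMaximal.ne_bot_of_isIntegral_int _
  have hP0 : P ≠ ⊥ := Ideal.ne_bot_of_liesOver_of_ne_bot hp0 P
  have hle : P.inertia Gal(L/ℚ) ≤ H := le_iSup_of_le ⟨P, hP, hP0⟩ le_rfl
  rw [← Ideal.ramificationIdx_eq_one_iff]
  have h1 : Nat.card (P.inertia Gal(L/ℚ)) = P.ramificationIdx ℤ := by
    rw [Ideal.card_inertia_eq_ramificationIdxIn (R := ℤ) (P.under ℤ) P,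
      Ideal.ramificationIdxIn_eq_ramificationIdx (P.under ℤ) P Gal(L/ℚ)]
  have h2 : Nat.card (P.inertia H) = P.ramificationIdx (𝓞 F) := by
    rw [Ideal.card_inertia_eq_ramificationIdxIn (R := 𝓞 F) p P,
      Ideal.ramificationIdxIn_eq_ramificationIdx p P H]
  have h3 : Nat.card (P.inertia H) = Nat.card (P.inertia Gal(L/ℚ)) :=
    Nat.card_congr (Subgroup.subgroupOfEquivOfLe hle).toEquiv
  have h4 := Ideal.ramificationIdx_tower (R := ℤ) p P
  have : 0 < P.ramificationIdx (𝓞 F) := Ideal.ramificationIdx_pos _ _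
  rw [← h1, ← h2, h3] at h4
  exact Nat.eq_of_mul_eq_mul_right (h3 ▸ h2 ▸ this) (by rw [← h4, one_mul])

/-- The union of all inertia groups generates `G`, and all orders of its elements divide `n`. -/
theorem generatorExponent_le {G : Type*} [Group G] [Finite G] {n : ℕ}
    (hn : n ∈ tameInertiaBounds ℚ G) : generatorExponent G ≤ n := by
  obtain ⟨hn0, L, _, _, hA, ⟨hG, ⟨φ⟩⟩, -, hI⟩ := hn
  obtain rfl := Subsingleton.elim hA DivisionRing.toRatAlgebra
  classical
  have := Fintype.ofFinite G
  let T : Set Gal(L/ℚ) := ⋃ P : {P : Ideal (𝓞 L) // P.IsPrime ∧ P ≠ ⊥}, P.1.inertia Gal(L/ℚ)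
  have hT : Subgroup.closure T = ⊤ := by
    rw [← iSup_inertia_eq_top (L := L), ← Subgroup.iSup_eq_closure]
  let S : Finset G := (φ '' T).toFinset
  have hS : Subgroup.closure (S : Set G) = ⊤ := by
    rw [Set.coe_toFinset]
    have := MonoidHom.map_closure φ.toMonoidHom T
    rw [hT] at this
    exact this.symm.trans (Subgroup.map_top_of_surjective _ φ.surjective)
  have hle : generatorExponent G ≤ S.lcm orderOf := Nat.sInf_le ⟨S, hS, rfl⟩
  refine hle.trans (Nat.le_of_dvd hn0 (Finset.lcm_dvd fun x hx ↦ ?_))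
  obtain ⟨y, hy, rfl⟩ := Set.mem_toFinset.1 hx
  obtain ⟨⟨P, hP, hP0⟩, hy⟩ := Set.mem_iUnion.1 hy
  rw [MulEquiv.orderOf_eq]
  exact (Subgroup.orderOf_dvd_natCard _ hy).trans (hI P hP hP0)

section

open Ideal

/-! ### Tame inertia -/

/-- Triviality of tame elements of the wild inertia group: an element of the inertia group at `P` that
acts trivially on `P / P ^ 2` and whose order is prime to the residue characteristic is the identity. -/
theorem smul_eq_of_tame {B G : Type*} [CommRing B] [IsDedekindDomain B] [Group G]
    [MulSemiringAction G B] (P : Ideal B) [P.IsPrime] {τ : G} (h₁ : ∀ x, τ • x - x ∈ P)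
    (h₂ : ∀ x ∈ P, τ • x - x ∈ P ^ 2) {m : ℕ} (hτ : τ ^ m = 1) (hm : (m : B) ∉ P) (x : B) :
    τ • x = x := by
  -- `τ` acts trivially on each graded piece `P ^ i / P ^ (i + 1)`
  have graded (i : ℕ) : ∀ x ∈ P ^ i, τ • x - x ∈ P ^ (i + 1) := by
    induction i with
    | zero => simpa using h₁
    | succ i ih =>
      intro x hx
      rw [pow_succ] at hx
      induction hx using Submodule.mul_induction_on' with
      | mem_mul_mem a ha b hb =>
        have ha' : τ • a ∈ P ^ i := by
          simpa using add_mem (Ideal.pow_le_pow_right (Nat.le_succ i) (ih a ha)) ha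
        have e : τ • (a * b) - a * b = τ • a * (τ • b - b) + (τ • a - a) * b := by
          rw [smul_mul']; ring
        rw [e]
        refine add_mem ?_ ?_
        · rw [show i + 1 + 1 = i + 2 from rfl, pow_add]
          exact Ideal.mul_mem_mul ha' (h₂ b hb)
        · rw [pow_succ]
          exact Ideal.mul_mem_mul (ih a ha) hb
      | add a _ b _ ha hb =>
        have e : τ • (a + b) - (a + b) = (τ • a - a) + (τ • b - b) := by rw [smul_add]; ring
        exact e ▸ add_mem ha hb
  have stable (i : ℕ) {x : B} (hx : x ∈ P ^ i) : τ • x ∈ P ^ i := by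
    simpa using add_mem (Ideal.pow_le_pow_right (Nat.le_succ i) (graded i x hx)) hx
  -- hence a displacement `τ x - x` lying in `P ^ i` lies in `P ^ (i + 1)`:
  -- modulo `P ^ (i + 1)`, the power `τ ^ m = 1` displaces `x` by `m` times as much
  have deeper (i : ℕ) : ∀ x, τ • x - x ∈ P ^ i := by
    induction i with
    | zero => simp
    | succ i ih =>
      intro x
      have hk (k : ℕ) : τ ^ k • x - x - k * (τ • x - x) ∈ P ^ (i + 1) := by
        induction k with
        | zero => simp
        | succ k ihk =>
          have hc : τ • (k : B) = k := map_natCast (MulSemiringAction.toRingHom G B τ) k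
          have e : τ ^ (k + 1) • x - x - ((k + 1 : ℕ) : B) * (τ • x - x) =
              τ • (τ ^ k • x - x - k * (τ • x - x)) +
                k * (τ • (τ • x - x) - (τ • x - x)) := by
            rw [pow_succ', mul_smul, smul_sub, smul_sub, smul_mul', hc]
            push_cast
            ring
          rw [e]
          exact add_mem (stable _ ihk) (Ideal.mul_mem_left _ _ (graded i _ (ih x)))
      have h := hk m
      rw [hτ, one_smul, sub_self, zero_sub, neg_mem_iff] at h
      exact (IsPrime.mul_mem_pow P h).resolve_left hm
  have : τ • x - x ∈ ⨅ i, P ^ i := by simpa [Ideal.mem_iInf] using fun i ↦ deeper i x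
  rw [Ideal.iInf_pow_eq_bot_of_isDomain P IsPrime.ne_top'] at this
  exact sub_eq_zero.1 this

/-! ### Orders at primes and roots of uniformizers -/

theorem emultiplicity_span_singleton_eq_one {A : Type*} [CommRing A] [IsDedekindDomain A]
    {p : Ideal A} {a : A} (ha : a ∈ p) (ha' : a ∉ p ^ 2) :
    emultiplicity p (span {a}) = 1 := by
  rw [← Nat.cast_one, emultiplicity_eq_coe, dvd_span_singleton, dvd_span_singleton, pow_one]
  exact ⟨ha, ha'⟩

theorem emultiplicity_span_algebraMap {B C : Type*} [CommRing B] [IsDedekindDomain B] [CommRing C]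
    [IsDedekindDomain C] [Algebra B C] [Module.IsTorsionFree B C] {P : Ideal B} [P.IsPrime]
    (hP : P ≠ ⊥) (Q : Ideal C) [Q.IsPrime] [Q.LiesOver P] {x : B} (hx : x ≠ 0) :
    emultiplicity Q (span {algebraMap B C x}) =
      Q.ramificationIdx B * emultiplicity P (span {x}) := by
  have hQ : Q ≠ ⊥ := ne_bot_of_liesOver_of_ne_bot hP Q
  rw [← ramificationIdx'_eq_ramificationIdx P Q hP,
    ← IsDedekindDomain.emultiplicity_map_eq_ramificationIdx'_mul
      (by simpa using hx) (prime_of_isPrime hP ‹_›).irreducible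
      (prime_of_isPrime hQ ‹_›).irreducible hQ, map_span, Set.image_singleton]

/-- An inertia element at `Q` that fixes some `β` of order `k` at `Q` acts trivially on
`Q ^ k / Q ^ (k + 1)`: it acts trivially on the residues of the quotients `x / β`. -/
theorem smul_sub_mem_pow_succ {C G : Type*} [CommRing C] [IsDedekindDomain C] [Group G]
    [MulSemiringAction G C] {Q : Ideal C} [Q.IsPrime] {σ : G} (hσ : ∀ x, σ • x - x ∈ Q)
    {β : C} (hβ : σ • β = β) {k : ℕ} (hk : emultiplicity Q (span {β}) = k) {x : C}
    (hx : x ∈ Q ^ k) : σ • x - x ∈ Q ^ (k + 1) := by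
  obtain ⟨⟨J, hJ⟩, hk'⟩ := emultiplicity_eq_coe.1 hk
  have hJQ : ¬ J ≤ Q := fun h ↦ hk' <| by
    rw [hJ, pow_succ]
    exact mul_dvd_mul_left _ (dvd_iff_le.2 h)
  obtain ⟨t, htJ, htQ⟩ := Set.not_subset.1 hJQ
  have hβQ : β ∈ Q ^ k := dvd_span_singleton.1 (Dvd.intro _ hJ.symm)
  -- locally at `Q`, the quotient `x / β` is the fraction `s / t`
  obtain ⟨s, hs⟩ : ∃ s, s * β = x * t := by
    rw [← mem_span_singleton', hJ]
    exact mul_mem_mul hx htJ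
  have hσs : σ • s * β = σ • x * σ • t := by
    rw [← smul_mul', ← hs, smul_mul', hβ]
  have e : (t * σ • t) * (σ • x - x) = β * ((σ • s - s) * t - s * (σ • t - t)) := by
    linear_combination -t * hσs + (σ • t) * hs
  have hmem : (t * σ • t) * (σ • x - x) ∈ Q ^ (k + 1) := by
    rw [e, pow_succ]
    exact mul_mem_mul hβQ
      (sub_mem (Q.mul_mem_right _ (hσ s)) (Q.mul_mem_left _ (hσ t)))
  have hσt : σ • t ∉ Q := fun h ↦ htQ (by simpa using sub_mem h (hσ t))
  rw [mul_assoc] at hmem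
  have h1 := (IsPrime.mul_mem_pow Q hmem).resolve_left htQ
  exact (IsPrime.mul_mem_pow Q h1).resolve_left hσt

/-- Let `σ` be an inertia element at `Q` which restricts to `τ` on `B`. If `σ` fixes an `e(P|p)`-th root
of a uniformizer `a` of `p`, then `τ` acts trivially on `P / P ^ 2`. -/
theorem smul_sub_mem_sq_of_pow_eq {A B C G H : Type*} [CommRing A] [IsDedekindDomain A]
    [CommRing B] [IsDedekindDomain B] [CommRing C] [IsDedekindDomain C] [Algebra A B] [Algebra B C]
    [Module.Finite A B] [Module.Finite B C]
    [Algebra A C] [IsScalarTower A B C] [Module.IsTorsionFree A B] [Module.IsTorsionFree B C]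
    [Group G] [MulSemiringAction G B] [Group H] [MulSemiringAction H C]
    {p : Ideal A} [p.IsPrime] (hp : p ≠ ⊥) {a : A} (ha : a ∈ p) (ha' : a ∉ p ^ 2)
    {P : Ideal B} [P.IsPrime] [P.LiesOver p] {Q : Ideal C} [Q.IsPrime] [Q.LiesOver P]
    {σ : H} (hσ : ∀ x, σ • x - x ∈ Q) {β : C} (hβ : σ • β = β)
    (hβa : β ^ P.ramificationIdx A = algebraMap A C a)
    {τ : G} (hτ : ∀ x, algebraMap B C (τ • x) = σ • algebraMap B C x) {x : B} (hx : x ∈ P) :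
    τ • x - x ∈ P ^ 2 := by
  have hP : P ≠ ⊥ := ne_bot_of_liesOver_of_ne_bot hp P
  have hQ : Q ≠ ⊥ := ne_bot_of_liesOver_of_ne_bot hP Q
  have ha0 : a ≠ 0 := fun h ↦ ha' (h ▸ zero_mem _)
  have haB : algebraMap A B a ≠ 0 := by simpa using ha0
  set e := P.ramificationIdx A
  have he : e ≠ 0 := (ramificationIdx_pos P A).ne'
  set k := Q.ramificationIdx B
  have hk0 : k ≠ 0 := (ramificationIdx_pos Q B).ne'
  -- comparing the orders at `Q` of both sides of `β ^ e = a` shows that `β` has order `e(Q/P)`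
  have hk : emultiplicity Q (span {β}) = k := by
    have h1 : emultiplicity Q (span {β ^ e}) = k * e := by
      rw [hβa, IsScalarTower.algebraMap_apply A B C, emultiplicity_span_algebraMap hP Q haB,
        emultiplicity_span_algebraMap hp P ha0, emultiplicity_span_singleton_eq_one ha ha', mul_one]
    rw [← span_singleton_pow, emultiplicity_pow (prime_of_isPrime hQ ‹_›), mul_comm] at h1
    have hβ0 : β ≠ 0 := by
      rintro rfl
      rw [zero_pow he, IsScalarTower.algebraMap_apply A B C] at hβa
      exact haB (FaithfulSMul.algebraMap_injective B C (by rw [← hβa, map_zero]))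
    have hfin := FiniteMultiplicity.of_prime_left (prime_of_isPrime hQ ‹_›)
      (b := span {β}) (by simpa using hβ0)
    rw [hfin.emultiplicity_eq_multiplicity] at h1 ⊢
    exact_mod_cast Nat.eq_of_mul_eq_mul_right he.bot_lt (by exact_mod_cast h1)
  have hxQ : algebraMap B C x ∈ Q ^ k := by
    have h : P.map (algebraMap B C) ≤ Q ^ P.ramificationIdx' Q := le_pow_ramificationIdx'
    rw [ramificationIdx'_eq_ramificationIdx P Q hP] at h
    exact h (mem_map_of_mem _ hx)
  have hmem := smul_sub_mem_pow_succ hσ hβ hk hxQ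
  rw [← hτ, ← map_sub] at hmem
  by_cases h0 : τ • x - x = 0
  · simp [h0]
  rw [← dvd_span_singleton, pow_dvd_iff_le_emultiplicity, emultiplicity_span_algebraMap hP Q h0]
    at hmem
  rw [← dvd_span_singleton, pow_dvd_iff_le_emultiplicity]
  by_contra! hlt
  have hle : emultiplicity P (span {τ • x - x}) ≤ 1 :=
    Order.le_of_lt_add_one (by simpa [one_add_one_eq_two] using hlt)
  have := hmem.trans (mul_le_mul_right hle _)
  rw [mul_one] at this
  exact absurd (ENat.natCast_le_natCast.1 this) (Nat.not_succ_le_self k)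

open Polynomial

/-! ### Choice of the radicand -/

theorem ramificationIdx_eq_one_of_discr_notMem (K : Type*) {L : Type*} [Field K] [NumberField K]
    [Field L] [NumberField L] [Algebra K L] (P : Ideal (𝓞 L)) [P.IsPrime] (hP : P ≠ ⊥)
    (hd : (discr L : 𝓞 L) ∉ P) : P.ramificationIdx (𝓞 K) = 1 := by
  obtain ⟨l, hl⟩ := IsPrincipalIdealRing.principal (P.under ℤ)
  change P.under ℤ = span {l} at hl
  have hl0 : l ≠ 0 := by
    rintro rfl
    exact hP (eq_bot_of_comap_eq_bot (R := ℤ) (by simpa [under] using hl))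
  have hlp : Prime l := by
    rw [← span_singleton_prime hl0, ← hl]
    infer_instance
  have hlP : algebraMap ℤ (𝓞 L) l ∈ P := by
    rw [← mem_comap, ← under_def, hl]
    exact mem_span_singleton_self l
  have hunr : Algebra.IsUnramifiedIn (𝓞 L) (span {l}) := by
    rw [← not_dvd_discr_iff_isUnramifiedIn L (𝓞 L) hlp]
    rintro ⟨c, hc⟩
    exact hd (by rw [hc, Int.cast_mul]; exact P.mul_mem_right _ hlP)
  have h1 : P.ramificationIdx ℤ = 1 := hunr.ramificationIdx_eq_one ⟨hl.symm⟩
  exact Nat.dvd_one.1 (h1 ▸ ramificationIdx_above_dvd (R := ℤ) (P.under (𝓞 K)) P)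

theorem exists_mem_notMem_sq {A : Type*} [CommRing A] [IsDedekindDomain A] {N : A} (hN : N ≠ 0) :
    ∃ a : A, ∀ p : Ideal A, p.IsPrime → N ∈ p → p ≠ ⊥ → a ∈ p ∧ a ∉ p ^ 2 := by
  classical
  have hfin := Ideal.finite_factors (I := span {N}) (by simpa using hN)
  have hx (v : IsDedekindDomain.HeightOneSpectrum A) : ∃ x ∈ v.asIdeal, x ∉ v.asIdeal ^ 2 := by
    simpa using exists_mem_pow_notMem_pow_succ v.asIdeal v.ne_bot v.isPrime.ne_top 1
  choose x hx hx' using hx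
  obtain ⟨a, ha⟩ := IsDedekindDomain.exists_forall_sub_mem_ideal (s := hfin.toFinset)
    (fun v ↦ v.asIdeal) (fun _ ↦ 2) (fun v _ ↦ v.prime)
    (fun v _ w _ h h' ↦ h (IsDedekindDomain.HeightOneSpectrum.ext h')) (fun v ↦ x v)
  refine ⟨a, fun p hp hNp hp0 ↦ ?_⟩
  let v : IsDedekindDomain.HeightOneSpectrum A := ⟨p, hp, hp0⟩
  have hv := ha v (hfin.mem_toFinset.2 (dvd_span_singleton.2 hNp))
  constructor
  · simpa using add_mem (Ideal.pow_le_self two_ne_zero hv) (hx v)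
  · exact fun h ↦ hx' v (by simpa using sub_mem h hv)

/-- There is an `a` in `K` of order one at every prime of `K` that ramifies in `L`, and of order one at
some prime of `L`. The first property makes the roots of `a` absorb the ramification of `L`, the
second makes `X ^ n - a` irreducible over `L`. -/
theorem exists_tame_radicand (K L : Type*) [Field K] [NumberField K] [Field L] [NumberField L]
    [Algebra K L] : ∃ a : 𝓞 K,
      (∀ P : Ideal (𝓞 L), P.IsPrime → P ≠ ⊥ → P.ramificationIdx (𝓞 K) ≠ 1 →
        a ∈ P.under (𝓞 K) ∧ a ∉ P.under (𝓞 K) ^ 2) ∧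
      ∃ Q : Ideal (𝓞 L), Q.IsPrime ∧ Q ≠ ⊥ ∧ algebraMap (𝓞 K) (𝓞 L) a ∈ Q ∧
        algebraMap (𝓞 K) (𝓞 L) a ∉ Q ^ 2 := by
  -- `q * discr L` is divisible by all primes that ramify and by an unramified prime
  obtain ⟨q, hq, hqp⟩ := Nat.exists_infinite_primes ((discr L).natAbs + 1)
  have hqp' : Prime (q : ℤ) := Nat.prime_iff_prime_int.1 hqp
  have : (span {(q : ℤ)}).IsPrime := (span_singleton_prime hqp'.ne_zero).2 hqp'
  have hd : discr L ≠ 0 := discr_ne_zero L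
  obtain ⟨a, ha⟩ := exists_mem_notMem_sq (A := 𝓞 K) (N := ((q * discr L : ℤ) : 𝓞 K))
    (by exact_mod_cast mul_ne_zero hqp'.ne_zero hd)
  have key (P : Ideal (𝓞 L)) (hP : P.IsPrime) (hP0 : P ≠ ⊥)
      (h : ((q * discr L : ℤ) : 𝓞 L) ∈ P) : a ∈ P.under (𝓞 K) ∧ a ∉ P.under (𝓞 K) ^ 2 := by
    refine ha _ inferInstance ?_ fun h0 ↦ hP0 (eq_bot_of_comap_eq_bot h0)
    rw [under_def, mem_comap, map_intCast]
    exact h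
  refine ⟨a, fun P hP hP0 hram ↦ key P hP hP0 ?_, ?_⟩
  · have := not_imp_comm.1 (ramificationIdx_eq_one_of_discr_notMem K P hP0) hram
    rw [Int.cast_mul]
    exact P.mul_mem_left _ this
  · obtain ⟨Q, hQ, hQq⟩ := (inferInstance : Nonempty ((span {(q : ℤ)}).primesOver (𝓞 L)))
    have hQ0 : Q ≠ ⊥ := ne_bot_of_liesOver_of_ne_bot (p := span {(q : ℤ)})
      (by simpa using hqp.ne_zero) Q
    have hqQ : ((q : ℤ) : 𝓞 L) ∈ Q := by
      have : (q : ℤ) ∈ Q.under ℤ := hQq.over ▸ mem_span_singleton_self _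
      simpa using this
    obtain ⟨h1, h2⟩ := key Q hQ hQ0 (by rw [Int.cast_mul]; exact Q.mul_mem_right _ hqQ)
    have hdQ : (discr L : 𝓞 L) ∉ Q := by
      intro h
      have h' : discr L ∈ Q.under ℤ := by simpa using h
      rw [← hQq.over, mem_span_singleton] at h'
      have := Nat.le_of_dvd (Int.natAbs_pos.2 hd) (Int.natCast_dvd.1 h')
      omega
    have hp0 : Q.under (𝓞 K) ≠ ⊥ := fun h0 ↦ hQ0 (eq_bot_of_comap_eq_bot h0)
    have hm := emultiplicity_span_algebraMap hp0 Q (x := a) (by rintro rfl; simp at h2)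
    rw [ramificationIdx_eq_one_of_discr_notMem K Q hQ0 hdQ,
      emultiplicity_span_singleton_eq_one h1 h2, Nat.cast_one, mul_one, ← Nat.cast_one,
      emultiplicity_eq_coe, pow_one, dvd_span_singleton, dvd_span_singleton] at hm
    exact ⟨Q, hQ, hQ0, hm⟩

theorem irreducible_X_pow_sub_C_of_mem_of_notMem_sq {A : Type*} (F : Type*) [CommRing A]
    [IsDomain A] [IsIntegrallyClosed A] [Field F] [Algebra A F] [IsFractionRing A F] {P : Ideal A}
    (hP : P.IsPrime) {a : A} (ha : a ∈ P) (ha' : a ∉ P ^ 2) {n : ℕ} (hn : n ≠ 0) :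
    Irreducible (X ^ n - C (algebraMap A F a)) := by
  have hmonic : (X ^ n - C a).Monic := monic_X_pow_sub_C a hn
  have heis : (X ^ n - C a).IsEisensteinAt P := by
    refine hmonic.isEisensteinAt_of_mem_of_notMem hP.ne_top (fun {m} hm ↦ ?_) ?_
    · rw [natDegree_X_pow_sub_C] at hm
      rw [coeff_sub, coeff_X_pow, if_neg hm.ne, coeff_C, zero_sub, neg_mem_iff]
      split_ifs
      · exact ha
      · exact zero_mem _
    · simpa [coeff_X_pow, hn.symm] using ha'
  have := heis.irreducible hP hmonic.isPrimitive (by rw [natDegree_X_pow_sub_C]; exact hn.bot_lt)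
  rw [hmonic.irreducible_iff_irreducible_map_fraction_map (K := F)] at this
  simpa using this

theorem isField_adjoinRoot_tensorProduct {K L : Type*} [Field K] [Field L] [Algebra K L] {f : K[X]}
    (hf : Irreducible (f.map (algebraMap K L))) : IsField (AdjoinRoot f ⊗[K] L) := by
  have : Fact (Irreducible (f.map (algebraMap K L))) := ⟨hf⟩
  let e₁ : AdjoinRoot f ⊗[K] L ≃+* L ⊗[K] AdjoinRoot f :=
    (Algebra.TensorProduct.comm K _ _).toRingEquiv
  let e₂ : L ⊗[K] AdjoinRoot f ≃+* AdjoinRoot _ :=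
    (AdjoinRoot.tensorAlgEquiv f _ rfl).toRingEquiv
  let e₃ : AdjoinRoot
      (f.map (Algebra.TensorProduct.includeRight (R := K) (A := L) (B := K)).toRingHom) ≃+*
        AdjoinRoot (f.map (algebraMap K L)) :=
    AdjoinRoot.mapRingEquiv (Algebra.TensorProduct.rid K K L).toRingEquiv _ _ <| by
      rw [Polynomial.map_map]
      refine Associated.of_eq (congrArg (f.map ·) ?_)
      ext x
      simp [Algebra.algebraMap_eq_smul_one]
  exact ((e₁.trans e₂).trans e₃).toMulEquiv.isField (Field.toIsField _)

/-! ### Absorbing tame ramification -/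

/-- A form of Abhyankar's lemma: a tame extension `L₀/K` becomes unramified over every `M` containing an
`n`-th root of an element that is a uniformizer at all ramified primes, provided that `n` is a
multiple of all ramification indices. The hypothesis `hgen` says that `L` is generated by `L₀` over
`M`. No tameness of `M/K` is needed, so `n` may be divisible by residue characteristics. -/
theorem isUnramifiedExtension_of_pow_eq {K M L₀ L : Type*} [Field K] [NumberField K] [Field M]
    [NumberField M] [Field L₀] [NumberField L₀] [Field L] [NumberField L] [Algebra K M]
    [Algebra K L₀] [Algebra K L] [Algebra M L] [Algebra L₀ L] [IsScalarTower K M L]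
    [IsScalarTower K L₀ L] [IsGalois K L₀] [IsGalois M L]
    (hgen : ∀ σ : Gal(L/M), (∀ x : L₀, σ (algebraMap L₀ L x) = algebraMap L₀ L x) → σ = 1)
    (htame : IsTameExtension K L₀) {n : ℕ}
    (hn : ∀ P : Ideal (𝓞 L₀), P.IsPrime → P ≠ ⊥ → Nat.card (P.inertia Gal(L₀/K)) ∣ n)
    {a : 𝓞 K} (ha : ∀ P : Ideal (𝓞 L₀), P.IsPrime → P ≠ ⊥ → P.ramificationIdx (𝓞 K) ≠ 1 →
      a ∈ P.under (𝓞 K) ∧ a ∉ P.under (𝓞 K) ^ 2)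
    {α : 𝓞 M} (hα : α ^ n = algebraMap (𝓞 K) (𝓞 M) a) : IsUnramifiedExtension M L := by
  intro Q hQ hQ0
  rw [← card_inertia_eq_ramificationIdx, Subgroup.card_eq_one, eq_bot_iff]
  intro σ hσ
  rw [AddSubgroup.mem_inertia] at hσ
  set τ : Gal(L₀/K) := AlgEquiv.restrictNormalHom L₀ (σ.restrictScalars K)
  have hτσ (x : L₀) : algebraMap L₀ L (τ x) = σ (algebraMap L₀ L x) :=
    AlgEquiv.restrictNormal_commutes (σ.restrictScalars K) L₀ x
  have hτσ' (x : 𝓞 L₀) : algebraMap (𝓞 L₀) (𝓞 L) (τ • x) = σ • algebraMap (𝓞 L₀) (𝓞 L) x :=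
    RingOfIntegers.ext (hτσ x)
  set P := Q.under (𝓞 L₀) with hPQ
  have hP0 : P ≠ ⊥ := fun h0 ↦ hQ0 (eq_bot_of_comap_eq_bot h0)
  have hτ : τ ∈ P.inertia Gal(L₀/K) := by
    rw [AddSubgroup.mem_inertia]
    intro x
    change algebraMap (𝓞 L₀) (𝓞 L) (τ • x - x) ∈ Q
    rw [map_sub, hτσ']
    exact hσ _
  have he := card_inertia_eq_ramificationIdx (K := K) P
  have hτe : τ ^ P.ramificationIdx (𝓞 K) = 1 := by
    rw [← he]
    exact orderOf_dvd_iff_pow_eq_one.1 (Subgroup.orderOf_dvd_natCard _ hτ)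
  suffices hτ1 : τ = 1 from hgen σ fun x ↦ by rw [← hτσ, hτ1, AlgEquiv.one_apply]
  by_cases hram : P.ramificationIdx (𝓞 K) = 1
  · rwa [hram, pow_one] at hτe
  obtain ⟨h1, h2⟩ := ha P inferInstance hP0 hram
  obtain ⟨d, hd⟩ := he ▸ hn P inferInstance hP0
  -- the `e`-th root of `a` contained in `M`
  let β : 𝓞 L := algebraMap (𝓞 M) (𝓞 L) (α ^ d)
  have hβ : β ^ P.ramificationIdx (𝓞 K) = algebraMap (𝓞 K) (𝓞 L) a := by
    rw [← map_pow, ← pow_mul, mul_comm, ← hd, hα, ← IsScalarTower.algebraMap_apply]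
  have hσβ : σ • β = β := RingOfIntegers.ext (σ.commutes _)
  have hp0 : P.under (𝓞 K) ≠ ⊥ := fun h0 ↦ hP0 (eq_bot_of_comap_eq_bot h0)
  have hsq (x : 𝓞 L₀) (hx : x ∈ P) : τ • x - x ∈ P ^ 2 :=
    smul_sub_mem_sq_of_pow_eq hp0 h1 h2 hσ hσβ hβ hτσ' hx
  have hchar : (P.ramificationIdx (𝓞 K) : 𝓞 L₀) ∉ P := by
    rw [← Ideal.Quotient.eq_zero_iff_mem, map_natCast, ringChar.spec]
    exact htame P inferInstance hP0
  have hfix := smul_eq_of_tame P hτ hsq hτe hchar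
  have : FaithfulSMul Gal(L₀/K) (𝓞 L₀) := IsGaloisGroup.faithful (𝓞 K)
  exact eq_of_smul_eq_smul (α := 𝓞 L₀) fun x ↦ by rw [hfix x, one_smul]

theorem mem_unramifiedOverfieldDegrees_of_mem_tameInertiaBounds {K : Type u} [Field K]
    [NumberField K] {G : Type v} [Group G] [Finite G] {n : ℕ} (hn : n ∈ tameInertiaBounds K G) :
    n ∈ unramifiedOverfieldDegrees K G := by
  obtain ⟨hn0, L₀, _, _, _, hgal, htame, hI⟩ := hn
  have := hgal.1
  obtain ⟨a, ha, Q, hQ, -, haQ, haQ'⟩ := exists_tame_radicand K L₀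
  set f : K[X] := X ^ n - C (a : K) with hf
  have hfL : Irreducible (f.map (algebraMap K L₀)) := by
    rw [hf, Polynomial.map_sub, Polynomial.map_pow, map_X, map_C]
    exact irreducible_X_pow_sub_C_of_mem_of_notMem_sq L₀ hQ haQ haQ' hn0.ne'
  have hfmonic : f.Monic := monic_X_pow_sub_C _ hn0.ne'
  have : Fact (Irreducible f) := ⟨hfmonic.irreducible_of_irreducible_map _ _ hfL⟩
  let M := AdjoinRoot f
  have : FiniteDimensional K M := hfmonic.finite_adjoinRoot
  have : NumberField M := NumberField.of_module_finite K M
  let L := M ⊗[K] L₀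
  let : Field L := (isField_adjoinRoot_tensorProduct hfL).toField
  let : Algebra M L := Algebra.TensorProduct.leftAlgebra
  let : Algebra L₀ L := Algebra.TensorProduct.rightAlgebra
  let : Algebra K L := Algebra.TensorProduct.leftAlgebra
  have : NumberField L := NumberField.of_module_finite M L
  have hGL : IsGExtension M L G := .of_tensorProduct_algEquiv (K := K) (L₀ := L₀) .refl hgal
  have := hGL.1
  have hroot : AdjoinRoot.root f ^ n = algebraMap K M a := by
    have : AdjoinRoot.root f ^ n - AdjoinRoot.of f a = 0 := by
      simpa [hf] using AdjoinRoot.eval₂_root f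
    exact sub_eq_zero.1 this
  have hint : IsIntegral ℤ (AdjoinRoot.root f) := by
    refine .of_pow hn0 ?_
    rw [hroot]
    exact a.isIntegral_coe.algebraMap
  refine ⟨M, _, inferInstance, _, ⟨L, _, inferInstance, _, L₀, _, inferInstance, _,
    hGL, ?_, hgal, htame, ⟨.refl⟩⟩, ?_⟩
  · refine isUnramifiedExtension_of_pow_eq (K := K) (L₀ := L₀) (fun σ hσ ↦ ?_) htame hI ha
      (α := ⟨AdjoinRoot.root f, hint⟩) (RingOfIntegers.ext hroot)
    -- `M ⊗ L₀` is generated over `M` by the image of `L₀`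
    have : (σ : M ⊗[K] L₀ →ₐ[M] M ⊗[K] L₀) = AlgHom.id M (M ⊗[K] L₀) := by
      apply Algebra.TensorProduct.ext
      · ext
      · ext x
        exact hσ x
    exact AlgEquiv.ext fun x ↦ congr($this x)
  · rw [(AdjoinRoot.powerBasis hfmonic.ne_zero).finrank, AdjoinRoot.powerBasis_dim,
      natDegree_X_pow_sub_C]

end

theorem lemma2p1 (K : Type u) [Field K] [NumberField K] (G : Type v) [Group G] [Finite G] :
    minUnramifiedDegree K G = minInertiaBound K G ∧
      (generatorExponent G : ℕ∞) ≤ minUnramifiedDegree ℚ G := by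
  refine ⟨?_, le_iInf₂ fun n hn ↦ ?_⟩
  · rw [minUnramifiedDegree, minInertiaBound, Set.Subset.antisymm
      (fun _ ↦ mem_tameInertiaBounds_of_mem_unramifiedOverfieldDegrees)
      (fun _ ↦ mem_unramifiedOverfieldDegrees_of_mem_tameInertiaBounds)]
  · exact_mod_cast generatorExponent_le
      (mem_tameInertiaBounds_of_mem_unramifiedOverfieldDegrees hn)
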